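/- Let $0\le r\le c\le n$ be integers, let $R$ be a commutative ring (for instance $\mathbb{Z}$ or $\mathbb{C}$), and let $s_i=s_i(x_1,\dots,x_n)\in R[x_1,\dots,x_n]$ be the $i$-th elementary symmetric polynomial, with $s_0=1$ and $s_i=0$ for $i<0$ and for $i>n$. Let $\alpha=(\alpha_1<\dots<\alpha_r)$ and $\beta=(\beta_1<\dots<\beta_c)$ be strictly increasing sequences of positive integers with $\alpha_i\ge\beta_i$ for $1\le i\le r$. Let $D^k_{\alpha,\beta}$ be the $k\times k$ matrix obtained from the infinite banded Toeplitz matrix $(s_{j-i})_{i,j\ge 1}$ by removing the rows $\alpha_1,\dots,\alpha_r$ and the columns $\beta_1,\dots,\beta_c$ and then taking the leading $k\times k$ submatrix (the determinant of the empty matrix is $1$). Put $b=\binom{n}{c-r}$ and define polynomials $Q_0,\dots,Q_b$ in $x_1,\dots,x_n$ by $$\sum_{k=0}^{b}Q_{b-k}\,t^k=\prod_{\sigma\subseteq\{1,\dots,n\},\ |\sigma|=c-r}\Bigl(t-\prod_{i\in\sigma}x_i\Bigr).$$ Let $K=\max(\alpha_r-r,\ \beta_c-c)$, where the term of an empty sequence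 is read as $0$. Then $$\sum_{k=0}^{b}Q_{b-k}\,\det D^{k+j}_{\alpha,\beta}=0\qquad\text{for all integers } j\ge K.$$ Moreover, let $\lambda=(1-\beta_1,\dots,c-\beta_c)$ and $\kappa=(1-\alpha_1,\dots,r-\alpha_r)$, so that for $k\ge K$ the sequences $\lambda+k\mathbf 1^c$ and $\kappa+k\mathbf 1^r$ (obtained by adding $k$ to each entry) are partitions with $\kappa+k\mathbf 1^r\subseteq\lambda+k\mathbf 1^c$. Let $S_{\rho/\nu}(x_1,\dots,x_n)$ denote the skew Schur polynomial, that is, the sum over all semistandard tableaux of shape $\rho/\nu$ with entries in $\{1,\dots,n\}$ (rows weakly increasing, columns strictly increasing) of the product of $x_v$ over all entries $v$ of the tableau. Then $$\det D^k_{\alpha,\beta}=S_{(\lambda+k\mathbf 1^c)/(\kappa+k\mathbf 1^r)}(x_1,\dots,x_n)\qquad\text{for all integers } k\ge K,$$ so that, equivalently, $$\sum_{k=0}^{b}Q_{b-k}\,S_{(\lambda+(k+j)\mathbf 1^c)/(\kappa+(k+j)\mathbf 1^r)}(x_1,\dots,x_n)=0\qquad\text{for all integers } j\ge K.$$ The characteristic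 polynomial of this recurrence is $\sum_{k=0}^b Q_{b-k}t^k$; its roots are, by the definition of the $Q_i$, the products $\prod_{i\in\sigma}x_i$ with $|\sigma|=c-r$. -/

import Mathlib

/-- The infinite banded Toeplitz matrix `A = (s_{j-i})`, with rows and columns indexed by
`1, 2, 3, …`, where `s_m` is read as `0` for `m < 0` and for `m > n`. -/
def bandedToeplitz {A : Type*} [Zero A] (n : ℕ) (s : ℕ → A) (i j : ℕ) : A :=
  if i ≤ j ∧ j ≤ i + n then s (j - i) else 0

/-- The positive integers that are not among `γ_1, …, γ_m`, listed increasingly; the list is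
indexed from `0`. -/
noncomputable def remainingIndex {m : ℕ} (γ : Fin m → ℕ) (i : ℕ) : ℕ :=
  Nat.nth (fun p => 1 ≤ p ∧ p ∉ Set.range γ) i

/-- The matrix `D^k_{α,β}`: remove the rows `α_1, …, α_r` and the columns `β_1, …, β_c` from the
banded Toeplitz matrix of `s_0, …, s_n`, then keep the leading `k × k` submatrix. -/
noncomputable def toeplitzD {A : Type*} [Zero A] (n : ℕ) (s : ℕ → A) {r c : ℕ}
    (α : Fin r → ℕ) (β : Fin c → ℕ) (k : ℕ) : Matrix (Fin k) (Fin k) A :=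
  Matrix.of fun i j => bandedToeplitz n s (remainingIndex α i) (remainingIndex β j)

/-- `γ_m - m` for the last entry of a sequence `γ_1, …, γ_m`, and `0` for the empty sequence.
For a strictly increasing sequence of positive integers `m ≤ γ_m`, so nothing is truncated. -/
def lastExcess : (m : ℕ) → (Fin m → ℕ) → ℕ
  | 0, _ => 0
  | m + 1, γ => γ (Fin.last m) - (m + 1)

/-- The polynomial `∏_{σ ⊆ [n], |σ| = d} (t - ∏_{i ∈ σ} x_i)` in `t`. -/
noncomputable def productPoly (R : Type*) [CommRing R] (n d : ℕ) :
    Polynomial (MvPolynomial (Fin n) R) :=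
  ∏ σ ∈ Finset.powersetCard d (Finset.univ : Finset (Fin n)),
    (Polynomial.X - Polynomial.C (∏ i ∈ σ, MvPolynomial.X i))

/-- The polynomials `Q_0, …, Q_b`, `b = n.choose d`: `Q_i` is the coefficient of `t^(b-i)` in
`∏_{|σ| = d} (t - ∏_{i ∈ σ} x_i)`. -/
noncomputable def recurrenceCoeff (R : Type*) [CommRing R] (n d i : ℕ) : MvPolynomial (Fin n) R :=
  (productPoly R n d).coeff (n.choose d - i)

/-- The boxes `(row, column)`, indexed from `0`, of the skew shape `lam / mu`. -/
def skewCells (lam mu : YoungDiagram) : Finset (ℕ × ℕ) := lam.cells \ mu.cells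

/-- A filling of the skew shape `lam / mu` is a semistandard tableau if its rows are weakly
increasing and its columns strictly increasing. An entry `v : Fin n` stands for the integer `v + 1`
and carries the variable `x_{v+1}`. -/
def IsSkewTableau {lam mu : YoungDiagram} {n : ℕ} (T : skewCells lam mu → Fin n) : Prop :=
  (∀ p q : skewCells lam mu, p.1.1 = q.1.1 → p.1.2 ≤ q.1.2 → T p ≤ T q) ∧
  (∀ p q : skewCells lam mu, p.1.2 = q.1.2 → p.1.1 < q.1.1 → T p < T q)

open Classical in
/-- The skew Schur polynomial `S_{lam/mu}(x_1, …, x_n)`, the sum over all semistandard tableaux of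
shape `lam / mu` with entries at most `n` of the product of the variables of the entries. -/
noncomputable def skewSchur (R : Type*) [CommRing R] (n : ℕ) (lam mu : YoungDiagram) :
    MvPolynomial (Fin n) R :=
  ∑ T : skewCells lam mu → Fin n with IsSkewTableau T, ∏ p, MvPolynomial.X (T p)

/-- For a strictly increasing sequence `γ_1, …, γ_m`, the Young diagram with row lengths
`k + 1 - γ_1, k + 2 - γ_2, …, k + m - γ_m`, that is `(1 - γ_1, …, m - γ_m) + k · 1^m`. (These
lengths are non-negative as soon as `γ_m - m ≤ k`; a negative length is read as `0`.) -/
def shiftedDiagram {m : ℕ} (γ : Fin m → ℕ) (hγ : StrictMono γ) (k : ℕ) : YoungDiagram where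
  cells := (Finset.univ : Finset (Fin m)).biUnion fun i =>
    (Finset.range (k + (i + 1) - γ i)).image fun j => ((i : ℕ), j)
  isLowerSet := by
    have step : ∀ (d : ℕ) (a b : Fin m), (a : ℕ) + d = b → γ a + d ≤ γ b := by
      intro d
      induction d with
      | zero =>
        intro a b h
        have : a = b := Fin.ext (by omega)
        simp [this]
      | succ d ih =>
        intro a b h
        have hb := b.2
        have h1 := ih a ⟨a + d, by omega⟩ rfl
        have h2 : γ ⟨a + d, by omega⟩ < γ b := hγ (Fin.lt_def.2 (by simp; omega))
        omega
    rintro ⟨i, j⟩ ⟨i', j'⟩ hle hmem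
    obtain ⟨h1, h2⟩ := Prod.mk_le_mk.1 hle
    simp only [Finset.coe_biUnion, Finset.coe_univ, Set.mem_univ, Set.iUnion_true,
      Set.mem_iUnion, Finset.mem_coe, Finset.mem_image, Finset.mem_range, Prod.mk.injEq]
      at hmem ⊢
    obtain ⟨a, y, hy, rfl, rfl⟩ := hmem
    have ha := a.2
    have h3 := step (a - i') ⟨i', by omega⟩ a (by simp; omega)
    exact ⟨⟨i', by omega⟩, j', by simp only; omega, rfl, rfl⟩

/-- Row `i` of the diagram `shiftedDiagram γ hγ k` has the boxes `(i, j)`, `j < k + (i+1) - γ_i`. -/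
theorem mem_shiftedDiagram {m : ℕ} (γ : Fin m → ℕ) (hγ : StrictMono γ) (k i j : ℕ) :
    (i, j) ∈ shiftedDiagram γ hγ k ↔ ∃ h : i < m, j < k + (i + 1) - γ ⟨i, h⟩ := by
  rw [← YoungDiagram.mem_cells]
  simp only [shiftedDiagram, Finset.mem_biUnion, Finset.mem_univ, true_and, Finset.mem_image,
    Finset.mem_range, Prod.mk.injEq]
  constructor
  · rintro ⟨a, y, hy, rfl, rfl⟩
    exact ⟨a.2, hy⟩
  · rintro ⟨h, hj⟩
    exact ⟨⟨i, h⟩, j, hj, rfl, rfl⟩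

/-! Write `p` and `q` for the indices of the rows and columns that survive the deletion. The minor
is then `det (s_{q_j - p_i})`, and two independent arguments finish the proof.

The minor is a skew Schur polynomial by the dual Jacobi–Trudi identity
`det_elemSymm_eq_columnSchur`, proved by induction on the number of variables. Since `e_m(x_0, …,
x_n) = e_m + x_n e_{m-1}`, with `e` on the right taken in `x_0, …, x_{n-1}`, multilinearity splits
the determinant into a sum over the sets of columns in which `q_j` drops by one. Tableaux obey the
same recursion: the largest value occurs at most once in each column, at its bottom, and erasing it
lowers those `q_j`. Choices that spoil strict monotonicity give equal columns in the determinant and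
no tableaux. The shape fits because the deleted indices encode the rows of a diagram and the
surviving ones its columns (`lt_remainingIndex_iff`).

The recurrence comes from a transfer matrix. For `k ≥ K`, passing from `k` to `k + 1` puts one new
column on the left of the skew shape, in the `c - r` rows from `r` to `c - 1` (counted from zero).
Its entries form a strictly increasing tuple, and only the entries to its right in the same rows are
constrained by it. So the generating functions with bounded first column form a vector `v_k` with `M
v_k = v_{k+1}`, where `M σ τ` is the monomial of `τ` if `σ ≤ τ` and zero otherwise. In lexicographic
order `M` is triangular, so its characteristic polynomial is `∏ (t - ∏_{i ∈ σ} x_i)`, and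
Cayley–Hamilton gives the recurrence. -/

/-! ### Elementary symmetric polynomials in integer degree -/

/-- The elementary symmetric polynomial of integer degree `m` in `x 0, …, x (n - 1)`. -/
def elemSymm {A : Type*} [CommRing A] (x : ℕ → A) : ℕ → ℤ → A
  | 0, m => if m = 0 then 1 else 0
  | n + 1, m => elemSymm x n m + x n * elemSymm x n (m - 1)

theorem elemSymm_of_neg {A : Type*} [CommRing A] (x : ℕ → A) (n : ℕ) (m : ℤ) (hm : m < 0) :
    elemSymm x n m = 0 := by
  induction n generalizing m with
  | zero => simp [elemSymm, hm.ne]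
  | succ n ih => simp [elemSymm, ih m hm, ih (m - 1) (by omega)]

theorem elemSymm_natCast {A : Type*} [CommRing A] (x : ℕ → A) (n m : ℕ) :
    elemSymm x n m = ((Multiset.range n).map x).esymm m := by
  induction n generalizing m with
  | zero =>
    cases m with
    | zero => simp [elemSymm, Multiset.esymm]
    | succ m =>
      simp only [elemSymm, Multiset.esymm, Multiset.range_zero, Multiset.map_zero,
        Multiset.powersetCard_zero_right, Multiset.sum_zero]
      rw [if_neg (by omega)]
  | succ n ih =>
    cases m with
    | zero =>
      have h := ih 0
      simp only [elemSymm, Multiset.esymm, Multiset.powersetCard_zero_left, Multiset.map_singleton,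
        Multiset.prod_zero, Multiset.sum_singleton] at h ⊢
      rw [h, elemSymm_of_neg _ _ _ (by simp)]
      simp
    | succ m =>
      rw [elemSymm, ih, show ((m + 1 : ℕ) : ℤ) - 1 = (m : ℕ) by simp, ih]
      simp [Multiset.esymm, Multiset.range_succ, Multiset.powersetCard_cons, Multiset.map_map,
        Multiset.sum_map_mul_left]

/-! ### Tableaux listed by columns, and removal of the largest value -/

theorem StrictMono.int_add_sub_le {k : ℕ} {q : Fin k → ℤ} (hq : StrictMono q) {b b' : Fin k}
    (h : b ≤ b') : q b + ((b' : ℤ) - b) ≤ q b' := by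
  obtain ⟨b, hb⟩ := b
  obtain ⟨b', hb'⟩ := b'
  rw [Fin.mk_le_mk] at h
  induction b', h using Nat.le_induction with
  | base => simp
  | succ m hm ih =>
    have h1 := ih (by omega)
    have h2 : q ⟨m, by omega⟩ < q ⟨m + 1, hb'⟩ := hq (by simp)
    push_cast at h1 ⊢
    omega

/-- The cells `(b, t)` with `p b ≤ t < q b`; a skew shape whose columns are listed from right to
left, the coordinate `t - b` being constant along rows. -/
noncomputable def columnCells {k : ℕ} (p q : Fin k → ℤ) : Finset (Σ _ : Fin k, ℤ) :=
  Finset.univ.sigma fun b => Finset.Ico (p b) (q b)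

theorem mem_columnCells {k : ℕ} {p q : Fin k → ℤ} {z : Σ _ : Fin k, ℤ} :
    z ∈ columnCells p q ↔ p z.1 ≤ z.2 ∧ z.2 < q z.1 := by
  simp [columnCells]

/-- Semistandardness in the coordinates of `columnCells`. -/
def IsColumnTableau {k n : ℕ} {p q : Fin k → ℤ} (T : columnCells p q → Fin n) : Prop :=
  (∀ y z : columnCells p q, y.1.2 - y.1.1 = z.1.2 - z.1.1 → z.1.1 ≤ y.1.1 → T y ≤ T z) ∧
  (∀ y z : columnCells p q, y.1.1 = z.1.1 → y.1.2 < z.1.2 → T y < T z)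

open Classical in
/-- The generating function of the tableaux on `columnCells p q`. -/
noncomputable def columnSchur {A : Type*} [CommRing A] (x : ℕ → A) (n : ℕ) {k : ℕ}
    (p q : Fin k → ℤ) : A :=
  ∑ T : columnCells p q → Fin n with IsColumnTableau T, ∏ z, x (T z)

/-- Lower by one the entries of `q` whose index is not in `s`. -/
def lowerOff {k : ℕ} (q : Fin k → ℤ) (s : Finset (Fin k)) (b : Fin k) : ℤ :=
  if b ∈ s then q b else q b - 1

theorem lowerOff_le {k : ℕ} (q : Fin k → ℤ) (s : Finset (Fin k)) (b : Fin k) :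
    lowerOff q s b ≤ q b := by
  unfold lowerOff; split_ifs <;> omega

theorem sub_one_le_lowerOff {k : ℕ} (q : Fin k → ℤ) (s : Finset (Fin k)) (b : Fin k) :
    q b - 1 ≤ lowerOff q s b := by
  unfold lowerOff; split_ifs <;> omega

/-- The columns of a tableau in which the largest admissible value does not occur. -/
noncomputable def columnsWithoutLast {k n : ℕ} {p q : Fin k → ℤ}
    (T : columnCells p q → Fin (n + 1)) : Finset (Fin k) :=
  open Classical in Finset.univ.filter fun b => ∀ z, z.1.1 = b → T z ≠ Fin.last n

theorem mem_columnsWithoutLast {k n : ℕ} {p q : Fin k → ℤ}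
    {T : columnCells p q → Fin (n + 1)} {b : Fin k} :
    b ∈ columnsWithoutLast T ↔ ∀ z, z.1.1 = b → T z ≠ Fin.last n := by
  simp [columnsWithoutLast]

theorem IsColumnTableau.ne_last_iff {k n : ℕ} {p q : Fin k → ℤ}
    {T : columnCells p q → Fin (n + 1)} (hT : IsColumnTableau T) (z : columnCells p q) :
    T z ≠ Fin.last n ↔ z.1 ∈ columnCells p (lowerOff q (columnsWithoutLast T)) := by
  have hz := mem_columnCells.1 z.2
  -- Columns increase strictly, so nothing can stand below the largest value: it occupies the bottom
  -- cell of its column.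
  have key : ∀ y : columnCells p q, T y = Fin.last n → y.1.2 = q y.1.1 - 1 := by
    intro y hy
    have hy' := mem_columnCells.1 y.2
    by_contra hne
    have h := hT.2 y ⟨⟨y.1.1, y.1.2 + 1⟩, mem_columnCells.2 ⟨by simp; omega, by simp; omega⟩⟩ rfl
      (by simp)
    rw [hy] at h
    exact absurd h (Fin.le_last _).not_gt
  rw [mem_columnCells]
  constructor
  · intro h
    refine ⟨hz.1, ?_⟩
    unfold lowerOff
    split_ifs with hs
    · exact hz.2
    · rw [mem_columnsWithoutLast] at hs
      push Not at hs
      obtain ⟨y, hy1, hy2⟩ := hs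
      have h1 := key y hy2
      by_contra hlt
      have : y = z := by
        apply Subtype.ext
        refine Sigma.ext hy1 (heq_of_eq ?_)
        rw [h1, hy1]; omega
      exact h (this ▸ hy2)
  · rintro ⟨-, h⟩ hlast
    have h1 := key z hlast
    unfold lowerOff at h
    split_ifs at h with hs
    · exact mem_columnsWithoutLast.1 hs z rfl hlast
    · omega

theorem le_lowerOff_columnsWithoutLast {k n : ℕ} {p q : Fin k → ℤ} (hpq : p ≤ q)
    (T : columnCells p q → Fin (n + 1)) :
    p ≤ lowerOff q (columnsWithoutLast T) := by
  intro b
  unfold lowerOff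
  split_ifs with hs
  · exact hpq b
  · rw [mem_columnsWithoutLast] at hs
    push Not at hs
    obtain ⟨y, rfl, -⟩ := hs
    have := mem_columnCells.1 y.2
    exact Int.le_sub_one_of_lt (this.1.trans_lt this.2)

/-- Monotonicity could fail only for neighbouring columns with `q b' = q b + 1`, where `b'` is
lowered and `b` is not. Their bottom cells then lie in one row, with the largest value in the left
cell `b'` but not in the right cell `b`, against weak increase along rows. -/
theorem IsColumnTableau.strictMono_lowerOff {k n : ℕ} {p q : Fin k → ℤ} (hp : StrictMono p)
    (hq : StrictMono q) (hpq : p ≤ q)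
    {T : columnCells p q → Fin (n + 1)} (hT : IsColumnTableau T) :
    StrictMono (lowerOff q (columnsWithoutLast T)) := by
  intro b b' hbb
  have hle : p b' ≤ lowerOff q (columnsWithoutLast T) b' :=
    le_lowerOff_columnsWithoutLast hpq T b'
  have h1 := hq.int_add_sub_le hbb.le
  have h2 : (b : ℕ) < b' := hbb
  have h3 := hp hbb
  by_contra hcon
  rw [not_lt] at hcon
  have h4 := lowerOff_le q (columnsWithoutLast T) b
  have h5 := sub_one_le_lowerOff q (columnsWithoutLast T) b'
  have hlb : lowerOff q (columnsWithoutLast T) b = q b := by omega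
  have hlb' : lowerOff q (columnsWithoutLast T) b' = q b' - 1 := by omega
  have hb'q : q b' - 1 = q b := by omega
  have hcell' : (⟨b', q b' - 1⟩ : Σ _ : Fin k, ℤ) ∈ columnCells p q :=
    mem_columnCells.2 ⟨by simp; omega, by simp⟩
  have hcell : (⟨b, q b - 1⟩ : Σ _ : Fin k, ℤ) ∈ columnCells p q :=
    mem_columnCells.2 ⟨by simp; omega, by simp⟩
  have hlast' : T ⟨_, hcell'⟩ = Fin.last n := by
    by_contra h
    have := (mem_columnCells.1 ((hT.ne_last_iff _).1 h)).2
    simp only [hlb'] at this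
    omega
  have hlast : T ⟨_, hcell⟩ ≠ Fin.last n := by
    rw [hT.ne_last_iff, mem_columnCells]
    simp only [hlb]
    omega
  have h6 := hT.1 ⟨_, hcell'⟩ ⟨_, hcell⟩ (by simp; omega) hbb.le
  rw [hlast'] at h6
  exact hlast (le_antisymm (Fin.le_last _) h6)

theorem columnCells_lowerOff_subset {k : ℕ} (p q : Fin k → ℤ) (s : Finset (Fin k)) :
    columnCells p (lowerOff q s) ⊆ columnCells p q := by
  intro z hz
  rw [mem_columnCells] at hz ⊢
  exact ⟨hz.1, hz.2.trans_le (lowerOff_le q s z.1)⟩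

theorem columnCells_sdiff_lowerOff {k : ℕ} (p q : Fin k → ℤ) (s : Finset (Fin k))
    (hs : p ≤ lowerOff q s) :
    columnCells p q \ columnCells p (lowerOff q s) =
      sᶜ.map ⟨fun b => (⟨b, q b - 1⟩ : Σ _ : Fin k, ℤ), fun _ _ h => (Sigma.ext_iff.1 h).1⟩ := by
  ext ⟨b, t⟩
  have : p b ≤ lowerOff q s b := hs b
  simp only [Finset.mem_sdiff, mem_columnCells, Finset.mem_map, Finset.mem_compl]
  unfold lowerOff at this ⊢
  constructor
  · rintro ⟨h1, h2⟩
    split_ifs at h2 with hb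
    · omega
    · exact ⟨b, hb, Sigma.ext rfl (heq_of_eq (show q b - 1 = t by omega))⟩
  · rintro ⟨a, hb, hab⟩
    obtain ⟨rfl, h⟩ := Sigma.mk.inj_iff.1 hab
    obtain rfl := eq_of_heq h
    rw [if_neg hb] at this ⊢
    omega

/-- Extend a tableau on the lowered shape by the new largest value. -/
noncomputable def extendByLast {k n : ℕ} {p q : Fin k → ℤ} {s : Finset (Fin k)}
    (T : columnCells p (lowerOff q s) → Fin n) (z : columnCells p q) : Fin (n + 1) :=
  if h : z.1 ∈ columnCells p (lowerOff q s) then (T ⟨z.1, h⟩).castSucc else Fin.last n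

theorem extendByLast_ne_last_iff {k n : ℕ} {p q : Fin k → ℤ} {s : Finset (Fin k)}
    (T : columnCells p (lowerOff q s) → Fin n) (z : columnCells p q) :
    extendByLast T z ≠ Fin.last n ↔ z.1 ∈ columnCells p (lowerOff q s) := by
  unfold extendByLast
  split_ifs with h
  · simp [h, (Fin.castSucc_lt_last _).ne]
  · simp [h]

theorem isColumnTableau_extendByLast {k n : ℕ} {p q : Fin k → ℤ} {s : Finset (Fin k)}
    (hs : StrictMono (lowerOff q s))
    {T : columnCells p (lowerOff q s) → Fin n} (hT : IsColumnTableau T) :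
    IsColumnTableau (extendByLast T : columnCells p q → Fin (n + 1)) := by
  constructor
  · intro y z hyz hle
    by_cases hz : z.1 ∈ columnCells p (lowerOff q s)
    -- A larger column index lies further left, so strict monotonicity of the lowered ends keeps
    -- every cell to the left of `z` in the lowered shape.
    · have hy : y.1 ∈ columnCells p (lowerOff q s) := by
        have h1 := mem_columnCells.1 y.2
        rw [mem_columnCells] at hz ⊢
        have := hs.int_add_sub_le hle
        omega
      simp only [extendByLast, hz, hy, dif_pos, Fin.castSucc_le_castSucc_iff]
      exact hT.1 ⟨_, hy⟩ ⟨_, hz⟩ hyz hle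
    · simp only [extendByLast, hz, dif_neg, not_false_eq_true]
      exact Fin.le_last _
  · intro y z hyz hlt
    have hy : y.1 ∈ columnCells p (lowerOff q s) := by
      have h1 := mem_columnCells.1 y.2
      have h2 := mem_columnCells.1 z.2
      rw [mem_columnCells]
      have := sub_one_le_lowerOff q s y.1.1
      rw [← hyz] at h2
      omega
    by_cases hz : z.1 ∈ columnCells p (lowerOff q s)
    · simp only [extendByLast, hz, hy, dif_pos, Fin.castSucc_lt_castSucc_iff]
      exact hT.2 ⟨_, hy⟩ ⟨_, hz⟩ hyz hlt
    · simp only [extendByLast, hz, hy, dif_pos, dif_neg, not_false_eq_true]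
      exact Fin.castSucc_lt_last _

theorem columnsWithoutLast_extendByLast {k n : ℕ} {p q : Fin k → ℤ} {s : Finset (Fin k)}
    (hs : p ≤ lowerOff q s) (T : columnCells p (lowerOff q s) → Fin n) :
    columnsWithoutLast (extendByLast T : columnCells p q → Fin (n + 1)) = s := by
  ext b
  rw [mem_columnsWithoutLast]
  constructor
  · intro h
    by_contra hb
    have h1 : p b ≤ lowerOff q s b := hs b
    have h2 : lowerOff q s b = q b - 1 := if_neg hb
    have h3 := (extendByLast_ne_last_iff T _).1
      (h ⟨⟨b, q b - 1⟩, mem_columnCells.2 ⟨by simp; omega, by simp⟩⟩ rfl)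
    rw [mem_columnCells] at h3
    simp only at h3
    omega
  · rintro hb z rfl
    rw [extendByLast_ne_last_iff, mem_columnCells]
    have := mem_columnCells.1 z.2
    rwa [show lowerOff q s z.1.1 = q z.1.1 from if_pos hb]

theorem prod_extendByLast {A : Type*} [CommRing A] (x : ℕ → A) {k n : ℕ} {p q : Fin k → ℤ}
    {s : Finset (Fin k)} (hs : p ≤ lowerOff q s) (T : columnCells p (lowerOff q s) → Fin n) :
    ∏ z : columnCells p q, x (extendByLast T z) = x n ^ sᶜ.card * ∏ z, x (T z) := by
  classical
  let g : (Σ _ : Fin k, ℤ) → A := fun z =>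
    if h : z ∈ columnCells p (lowerOff q s) then x (T ⟨z, h⟩) else x n
  have h1 : ∏ z : columnCells p q, x (extendByLast T z) = ∏ z ∈ columnCells p q, g z := by
    rw [← Finset.prod_coe_sort (columnCells p q) g]
    refine Finset.prod_congr rfl fun z _ => ?_
    simp only [extendByLast, g]
    split_ifs <;> simp
  have h2 : ∏ z, x (T z) = ∏ z ∈ columnCells p (lowerOff q s), g z := by
    rw [← Finset.prod_coe_sort (columnCells p (lowerOff q s)) g]
    exact Finset.prod_congr rfl fun z _ => by simp [g]
  have h3 : ∏ z ∈ columnCells p q \ columnCells p (lowerOff q s), g z = x n ^ sᶜ.card := by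
    rw [Finset.prod_congr (g := fun _ => x n) rfl, Finset.prod_const,
      columnCells_sdiff_lowerOff p q s hs, Finset.card_map]
    intro z hz
    exact dif_neg (Finset.mem_sdiff.1 hz).2
  rw [h1, h2, ← h3, Finset.prod_sdiff (columnCells_lowerOff_subset p q s)]

-- Tableaux are sorted by the set `s` of columns avoiding the largest value. Erasing that value and
-- refilling with `extendByLast` are inverse bijections, and each of the columns outside `s`
-- contributes one factor `x n`.
open Classical in
theorem columnSchur_succ {A : Type*} [CommRing A] (x : ℕ → A) (n : ℕ) {k : ℕ} {p q : Fin k → ℤ}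
    (hp : StrictMono p) (hq : StrictMono q) (hpq : p ≤ q) :
    columnSchur x (n + 1) p q = ∑ s : Finset (Fin k),
      if StrictMono (lowerOff q s) ∧ p ≤ lowerOff q s then
        x n ^ sᶜ.card * columnSchur x n p (lowerOff q s) else 0 := by
  unfold columnSchur
  rw [← Finset.sum_fiberwise _ (fun T => columnsWithoutLast T)]
  refine Finset.sum_congr rfl fun s _ => ?_
  split_ifs with hs
  · rw [Finset.mul_sum]
    symm
    refine Finset.sum_bij' (fun T _ => extendByLast T)
      (fun T hT z => (T ⟨z.1, columnCells_lowerOff_subset p q s z.2⟩).castPred ?_) ?_ ?_ ?_ ?_ ?_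
    · simp only [Finset.mem_filter, Finset.mem_univ, true_and] at hT
      rw [hT.1.ne_last_iff, hT.2]
      exact z.2
    · intro T hT
      simp only [Finset.mem_filter, Finset.mem_univ, true_and] at hT ⊢
      exact ⟨isColumnTableau_extendByLast hs.1 hT, columnsWithoutLast_extendByLast hs.2 T⟩
    · intro T hT
      simp only [Finset.mem_filter, Finset.mem_univ, true_and] at hT ⊢
      constructor
      · intro y z h1 h2
        rw [Fin.castPred_le_castPred_iff]
        exact hT.1.1 _ _ h1 h2
      · intro y z h1 h2
        rw [Fin.castPred_lt_castPred_iff]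
        exact hT.1.2 _ _ h1 h2
    · intro T hT
      funext z
      simp [extendByLast]
    · intro T hT
      simp only [Finset.mem_filter, Finset.mem_univ, true_and] at hT
      funext z
      unfold extendByLast
      split_ifs with h
      · simp
      · by_contra hne
        apply h
        rw [← hT.2, ← hT.1.ne_last_iff]
        exact fun h => hne h.symm
    · intro T hT
      exact (prod_extendByLast x hs.2 T).symm
  · refine Finset.sum_eq_zero fun T hT => ?_
    simp only [Finset.mem_filter, Finset.mem_univ, true_and] at hT
    obtain ⟨hT, rfl⟩ := hT
    exact absurd ⟨hT.strictMono_lowerOff hp hq hpq, le_lowerOff_columnsWithoutLast hpq T⟩ hs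

/-! ### The dual Jacobi–Trudi identity -/

theorem det_elemSymm_succ {A : Type*} [CommRing A] (x : ℕ → A) (n : ℕ) {k : ℕ} (p q : Fin k → ℤ) :
    (Matrix.of fun i j => elemSymm x (n + 1) (q j - p i)).det = ∑ s : Finset (Fin k),
      x n ^ sᶜ.card * (Matrix.of fun i j => elemSymm x n (lowerOff q s j - p i)).det := by
  rw [← Matrix.det_transpose]
  have h : (Matrix.of fun i j => elemSymm x (n + 1) (q j - p i)).transpose =
      (fun j i => elemSymm x n (q j - p i)) + fun j i => x n * elemSymm x n (q j - 1 - p i) := by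
    ext j i
    simp only [Matrix.transpose_apply, Matrix.of_apply, elemSymm, Pi.add_apply]
    congr 3
    ring
  rw [h]
  -- Multilinear expansion over subsets: `s` collects the indices where the first summand, with `q
  -- j` unchanged, is chosen.
  refine (Matrix.detRowAlternating.toMultilinearMap.map_add_univ _ _).trans ?_
  refine Finset.sum_congr rfl fun s _ => ?_
  have h1 : x n ^ sᶜ.card = ∏ j, (if j ∈ s then 1 else x n) := by
    rw [Finset.prod_ite, Finset.prod_const_one, one_mul, Finset.prod_const]
    congr 2
    ext; simp
  rw [h1, ← Matrix.det_mul_row, ← Matrix.det_transpose]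
  change Matrix.det _ = _
  congr 1
  ext j i
  by_cases hj : j ∈ s <;> simp [Finset.piecewise, hj, lowerOff]

theorem det_elemSymm_zero {A : Type*} [CommRing A] (x : ℕ → A) {k : ℕ} {p q : Fin k → ℤ}
    (hp : StrictMono p) (hq : StrictMono q) :
    (Matrix.of fun i j => elemSymm x 0 (q j - p i)).det = if p = q then 1 else 0 := by
  split_ifs with h
  · subst h
    rw [← Matrix.det_one (n := Fin k) (R := A)]
    congr 1
    ext i j
    simp only [Matrix.of_apply, elemSymm, sub_eq_zero, hp.injective.eq_iff, Matrix.one_apply,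
      eq_comm]
  · by_contra hdet
    -- Without variables the entries are `1` where `p i = q j` and `0` elsewhere. A nonzero
    -- determinant has no zero column, so `p` and `q` have the same range, and strictly increasing
    -- sequences with equal range coincide.
    have hex : ∀ j, ∃ i, p i = q j := by
      intro j
      by_contra hj
      push Not at hj
      refine hdet (Matrix.det_eq_zero_of_column_eq_zero j fun i => ?_)
      simp only [Matrix.of_apply, elemSymm]
      rw [if_neg (by have := hj i; omega)]
    choose f hf using hex
    have hinj : Function.Injective f := fun a b hab => hq.injective (by rw [← hf, ← hf, hab])
    have hsurj := Finite.injective_iff_surjective.1 hinj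
    apply h
    refine (hp.range_inj hq).1 ?_
    rw [show q = p ∘ f from funext fun j => (hf j).symm, hsurj.range_comp]

open Classical in
/-- The dual Jacobi–Trudi identity for skew shapes, in column coordinates. -/
theorem det_elemSymm_eq_columnSchur {A : Type*} [CommRing A] (x : ℕ → A) (n : ℕ) {k : ℕ}
    {p q : Fin k → ℤ} (hp : StrictMono p) (hq : StrictMono q) :
    (Matrix.of fun i j => elemSymm x n (q j - p i)).det =
      if p ≤ q then columnSchur x n p q else 0 := by
  induction n generalizing q with
  | zero =>
    rw [det_elemSymm_zero x hp hq]
    by_cases hpq : p ≤ q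
    · rw [if_pos hpq]
      unfold columnSchur
      by_cases h : p = q
      · have : IsEmpty (columnCells p q) := by
          subst h
          exact ⟨fun z => by have := mem_columnCells.1 z.2; omega⟩
        rw [if_pos h, Finset.sum_filter, Fintype.sum_unique, if_pos, Fintype.prod_empty]
        exact ⟨fun y => isEmptyElim y, fun y => isEmptyElim y⟩
      · rw [if_neg h]
        have : ∃ b, p b ≠ q b := Function.ne_iff.1 h
        obtain ⟨b, hb⟩ := this
        have hb' : p b ≤ q b := hpq b
        symm
        refine Finset.sum_eq_zero fun T _ => ?_
        exact (T ⟨⟨b, p b⟩, mem_columnCells.2 ⟨le_rfl, by simp; omega⟩⟩).elim0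
    · rw [if_neg hpq, if_neg fun h => hpq h.le]
  | succ n ih =>
    rw [det_elemSymm_succ]
    have hterm : ∀ s : Finset (Fin k),
        x n ^ sᶜ.card * (Matrix.of fun i j => elemSymm x n (lowerOff q s j - p i)).det =
        if StrictMono (lowerOff q s) ∧ p ≤ lowerOff q s then
        x n ^ sᶜ.card * columnSchur x n p (lowerOff q s) else 0 := by
      intro s
      by_cases hs : StrictMono (lowerOff q s)
      · rw [ih hs]
        by_cases h : p ≤ lowerOff q s <;> simp [h, hs]
      · rw [if_neg fun h => hs h.1]
        unfold StrictMono at hs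
        push Not at hs
        obtain ⟨b, b', hlt, hle⟩ := hs
        have h1 := hq hlt
        have h2 := lowerOff_le q s b
        have h3 := sub_one_le_lowerOff q s b'
        -- Lowering costs at most one, so strict monotonicity can only degenerate into equality,
        -- which produces two equal columns.
        have heq : lowerOff q s b = lowerOff q s b' := by omega
        rw [Matrix.det_zero_of_column_eq hlt.ne fun i => by simp [heq], mul_zero]
    rw [Finset.sum_congr rfl fun s _ => hterm s]
    split_ifs with hpq
    · rw [columnSchur_succ x n hp hq hpq]
    · refine Finset.sum_eq_zero fun s _ => if_neg fun h => hpq (h.2.trans (lowerOff_le q s))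

/-! ### Remaining indices as column lengths of the diagrams -/

theorem infinite_remaining {m : ℕ} (γ : Fin m → ℕ) :
    (Set.ofPred fun p : ℕ => 1 ≤ p ∧ p ∉ Set.range γ).Infinite := by
  have h : (Set.ofPred fun p : ℕ => 1 ≤ p ∧ p ∉ Set.range γ) = ({0} ∪ Set.range γ)ᶜ := by
    ext p
    change (1 ≤ p ∧ p ∉ Set.range γ) ↔ _
    simp [Nat.one_le_iff_ne_zero]
  rw [h]
  exact ((Set.finite_singleton 0).union (Set.finite_range γ)).infinite_compl

theorem strictMono_remainingIndex {m : ℕ} (γ : Fin m → ℕ) : StrictMono (remainingIndex γ) :=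
  Nat.nth_strictMono (infinite_remaining γ)

theorem succ_le_remainingIndex {m : ℕ} (γ : Fin m → ℕ) (b : ℕ) : b + 1 ≤ remainingIndex γ b := by
  induction b with
  | zero => exact (Nat.nth_mem_of_infinite (infinite_remaining γ) 0).1
  | succ b ih =>
    have := strictMono_remainingIndex γ (Nat.lt_add_one b)
    omega

/-- With `N = i + b + 1`, the remaining index number `b` (from zero) exceeds `N` exactly when at
most `b` of the integers `1, …, N` remain, that is, when at least `i + 1` terms of `γ` are at most
`N`. -/
theorem lt_remainingIndex_iff {m : ℕ} {γ : Fin m → ℕ} (hγ : StrictMono γ) (hpos : ∀ i, 1 ≤ γ i)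
    (i b : ℕ) : i + b + 1 < remainingIndex γ b ↔ ∃ h : i < m, γ ⟨i, h⟩ ≤ i + b + 1 := by
  classical
  set N := i + b + 1 with hN
  have hcount : Nat.count (fun p : ℕ => 1 ≤ p ∧ p ∉ Set.range γ) (N + 1) =
      N - (Finset.univ.filter fun l => γ l ≤ N).card := by
    rw [Nat.count_eq_card_filter_range, ← Finset.card_image_of_injective _ hγ.injective]
    have : (Finset.range (N + 1)).filter (fun p : ℕ => 1 ≤ p ∧ p ∉ Set.range γ) =
        Finset.Icc 1 N \ (Finset.univ.filter fun l => γ l ≤ N).image γ := by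
      ext p
      simp only [Finset.mem_filter, Finset.mem_range, Set.mem_range, Finset.mem_sdiff,
        Finset.mem_Icc, Finset.mem_image, Finset.mem_univ, true_and, not_exists, not_and]
      constructor
      · rintro ⟨h1, h2, h3⟩
        exact ⟨⟨h2, by omega⟩, fun l _ => h3 l⟩
      · rintro ⟨⟨h1, h2⟩, h3⟩
        exact ⟨by omega, h1, fun l hl => h3 l (by omega) hl⟩
    rw [this, Finset.card_sdiff_of_subset, Nat.card_Icc, Nat.add_sub_cancel]
    intro p
    simp only [Finset.mem_image, Finset.mem_filter, Finset.mem_univ, true_and, Finset.mem_Icc]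
    rintro ⟨l, hl, rfl⟩
    exact ⟨hpos l, hl⟩
  rw [← Nat.succ_le_iff, Nat.succ_eq_add_one, remainingIndex,
    ← Nat.count_le_iff_le_nth (infinite_remaining γ), hcount]
  have hiff : (i + 1 ≤ (Finset.univ.filter fun l => γ l ≤ N).card) ↔
      ∃ h : i < m, γ ⟨i, h⟩ ≤ N := by
    constructor
    · intro h
      by_contra hcon
      push Not at hcon
      have hsub : (Finset.univ.filter fun l => γ l ≤ N).map Fin.valEmbedding ⊆
          Finset.range i := by
        intro l
        simp only [Finset.mem_map, Finset.mem_filter, Finset.mem_univ, true_and,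
          Finset.mem_range]
        rintro ⟨l, hl, rfl⟩
        by_contra hil
        simp only [Fin.valEmbedding_apply, not_lt] at hil
        have him : i < m := hil.trans_lt l.2
        have := hcon him
        have h2 : γ ⟨i, him⟩ ≤ γ l := hγ.monotone hil
        omega
      have := Finset.card_le_card hsub
      rw [Finset.card_map, Finset.card_range] at this
      omega
    · rintro ⟨him, h⟩
      have hsub : Finset.Iic (⟨i, him⟩ : Fin m) ⊆ Finset.univ.filter fun l => γ l ≤ N := by
        intro l hl
        simp only [Finset.mem_filter, Finset.mem_univ, true_and]
        exact (hγ.monotone (Finset.mem_Iic.1 hl)).trans h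
      have := Finset.card_le_card hsub
      rwa [Fin.card_Iic] at this
  rw [← hiff]
  omega

theorem remainingIndex_le_remainingIndex {r c : ℕ} (hrc : r ≤ c) {α : Fin r → ℕ} {β : Fin c → ℕ}
    (hα : StrictMono α) (hβ : StrictMono β) (hα_pos : ∀ i, 1 ≤ α i) (hβ_pos : ∀ i, 1 ≤ β i)
    (hαβ : ∀ i : Fin r, β (Fin.castLE hrc i) ≤ α i) (b : ℕ) :
    remainingIndex α b ≤ remainingIndex β b := by
  by_contra! hlt
  -- Cutting at the value `remainingIndex β b` itself: the inequality for `α` passes to `β` through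
  -- `β_i ≤ α_i` and makes this index exceed itself.
  obtain ⟨i, hi⟩ := Nat.exists_eq_add_of_le (succ_le_remainingIndex β b)
  have hi : remainingIndex β b = i + b + 1 := by omega
  rw [hi, lt_remainingIndex_iff hα hα_pos] at hlt
  obtain ⟨hir, hle⟩ := hlt
  have := (lt_remainingIndex_iff hβ hβ_pos i b).2
    ⟨hir.trans_le hrc, (hαβ ⟨i, hir⟩).trans hle⟩
  omega

/-- Both sides say `γ_i ≤ i + b + 1`. Hence column `k - 1 - b` has `remainingIndex γ b - (b + 1)`
boxes, and box `i` of it has coordinate `t = i + b + 1` in `columnCells`. -/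
theorem mem_shiftedDiagram_iff {m : ℕ} {γ : Fin m → ℕ} (hγ : StrictMono γ) (hpos : ∀ i, 1 ≤ γ i)
    {k b : ℕ} (hb : b < k) (i : ℕ) :
    (i, k - 1 - b) ∈ shiftedDiagram γ hγ k ↔ i + b + 1 < remainingIndex γ b := by
  rw [mem_shiftedDiagram, lt_remainingIndex_iff hγ hpos]
  refine exists_congr fun h => ?_
  omega

theorem StrictMono.succ_le_of_pos {m : ℕ} {γ : Fin m → ℕ} (hγ : StrictMono γ)
    (hpos : ∀ i, 1 ≤ γ i) (i : ℕ) (h : i < m) : i + 1 ≤ γ ⟨i, h⟩ := by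
  induction i with
  | zero => exact hpos _
  | succ i ih =>
    have h1 := ih (by omega)
    have h2 : γ ⟨i, by omega⟩ < γ ⟨i + 1, h⟩ := hγ (by simp)
    omega

theorem snd_lt_of_mem_shiftedDiagram {m : ℕ} {γ : Fin m → ℕ} (hγ : StrictMono γ)
    (hpos : ∀ i, 1 ≤ γ i) {k i j : ℕ} (h : (i, j) ∈ shiftedDiagram γ hγ k) : j < k := by
  obtain ⟨him, h⟩ := (mem_shiftedDiagram γ hγ k i j).1 h
  have := hγ.succ_le_of_pos hpos i him
  omega

theorem mem_skewCells {lam mu : YoungDiagram} {z : ℕ × ℕ} :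
    z ∈ skewCells lam mu ↔ z ∈ lam ∧ z ∉ mu := by
  simp [skewCells]

/-- The columns of the skew diagram of `α` and `β` from right to left are described by the indices
that remain after removing `α` and `β`. -/
def skewCellsEquiv {r c : ℕ} {α : Fin r → ℕ} {β : Fin c → ℕ}
    (hα : StrictMono α) (hβ : StrictMono β) (hα_pos : ∀ i, 1 ≤ α i) (hβ_pos : ∀ i, 1 ≤ β i)
    (k : ℕ) :
    skewCells (shiftedDiagram β hβ k) (shiftedDiagram α hα k) ≃
      columnCells (fun b : Fin k => (remainingIndex α b : ℤ))
        (fun b : Fin k => (remainingIndex β b : ℤ)) where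
  toFun z := ⟨⟨⟨k - 1 - z.1.2, by
      have := snd_lt_of_mem_shiftedDiagram hβ hβ_pos (mem_skewCells.1 z.2).1
      omega⟩, (z.1.1 + (k - 1 - z.1.2 : ℕ) + 1 : ℕ)⟩, by
    obtain ⟨⟨i, j⟩, hz⟩ := z
    rw [mem_skewCells] at hz
    have hj := snd_lt_of_mem_shiftedDiagram hβ hβ_pos hz.1
    have h1 := mem_shiftedDiagram_iff hα hα_pos (k := k) (b := k - 1 - j) (by omega) i
    have h2 := mem_shiftedDiagram_iff hβ hβ_pos (k := k) (b := k - 1 - j) (by omega) i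
    rw [show k - 1 - (k - 1 - j) = j by omega] at h1 h2
    rw [h1, h2, not_lt] at hz
    rw [mem_columnCells]
    exact ⟨Int.ofNat_le.2 hz.2, Int.ofNat_lt.2 hz.1⟩⟩
  invFun z := ⟨((z.1.2 - z.1.1 - 1).toNat, k - 1 - z.1.1), by
    obtain ⟨⟨⟨b, hb⟩, t⟩, hz⟩ := z
    rw [mem_columnCells] at hz
    simp only at hz ⊢
    have h0 := succ_le_remainingIndex α b
    obtain ⟨i, hi⟩ : ∃ i : ℕ, t = (i + b + 1 : ℕ) := ⟨(t - b - 1).toNat, by omega⟩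
    rw [show (t - b - 1).toNat = i by omega, mem_skewCells, mem_shiftedDiagram_iff hα hα_pos hb,
      mem_shiftedDiagram_iff hβ hβ_pos hb]
    omega⟩
  left_inv z := by
    obtain ⟨⟨i, j⟩, hz⟩ := z
    have hj := snd_lt_of_mem_shiftedDiagram hβ hβ_pos (mem_skewCells.1 hz).1
    apply Subtype.ext
    refine Prod.ext ?_ ?_
    · simp only; omega
    · simp only; omega
  right_inv z := by
    obtain ⟨⟨⟨b, hb⟩, t⟩, hz⟩ := z
    rw [mem_columnCells] at hz
    simp only at hz
    have h0 := succ_le_remainingIndex α b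
    apply Subtype.ext
    refine Sigma.ext (Fin.ext ?_) (heq_of_eq ?_)
    · simp only; omega
    · simp only; omega

theorem isSkewTableau_comp_skewCellsEquiv {n r c : ℕ} {α : Fin r → ℕ} {β : Fin c → ℕ}
    (hα : StrictMono α) (hβ : StrictMono β) (hα_pos : ∀ i, 1 ≤ α i) (hβ_pos : ∀ i, 1 ≤ β i)
    (k : ℕ) (T : columnCells (fun b : Fin k => (remainingIndex α b : ℤ))
        (fun b : Fin k => (remainingIndex β b : ℤ)) → Fin n) :
    IsSkewTableau (T ∘ skewCellsEquiv hα hβ hα_pos hβ_pos k) ↔ IsColumnTableau T := by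
  let e := skewCellsEquiv hα hβ hα_pos hβ_pos k
  refine and_congr (e.forall_congr fun y => e.forall_congr fun z => ?_)
    (e.forall_congr fun y => e.forall_congr fun z => ?_)
  all_goals
    obtain ⟨⟨i, j⟩, hy⟩ := y
    obtain ⟨⟨i', j'⟩, hz⟩ := z
    have hj := snd_lt_of_mem_shiftedDiagram hβ hβ_pos (mem_skewCells.1 hy).1
    have hj' := snd_lt_of_mem_shiftedDiagram hβ hβ_pos (mem_skewCells.1 hz).1
    simp only [e, skewCellsEquiv, Equiv.coe_fn_mk, Function.comp_apply, Fin.mk_le_mk,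
      Fin.mk.injEq]
  · constructor
    · intro h h1 h2
      exact h (by omega) (by omega)
    · intro h h1 h2
      exact h (by omega) (by omega)
  · constructor
    · intro h h1 h2
      exact h (by omega) (by omega)
    · intro h h1 h2
      exact h (by omega) (by omega)

/-! ### Toeplitz minors as skew Schur polynomials -/

/-- The variables of `MvPolynomial (Fin n) R` as a sequence, continued by zero. -/
noncomputable def variableSeq (R : Type*) [CommRing R] (n i : ℕ) : MvPolynomial (Fin n) R :=
  if h : i < n then MvPolynomial.X ⟨i, h⟩ else 0

theorem variableSeq_val (R : Type*) [CommRing R] (n : ℕ) (i : Fin n) :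
    variableSeq R n i = MvPolynomial.X i := by
  simp [variableSeq]

theorem skewSchur_eq_columnSchur (R : Type*) [CommRing R] (n : ℕ) {r c : ℕ} {α : Fin r → ℕ}
    {β : Fin c → ℕ} (hα : StrictMono α) (hβ : StrictMono β) (hα_pos : ∀ i, 1 ≤ α i)
    (hβ_pos : ∀ i, 1 ≤ β i) (k : ℕ) :
    skewSchur R n (shiftedDiagram β hβ k) (shiftedDiagram α hα k) =
      columnSchur (variableSeq R n) n (fun b : Fin k => (remainingIndex α b : ℤ))
        (fun b : Fin k => (remainingIndex β b : ℤ)) := by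
  classical
  unfold skewSchur columnSchur
  let e := skewCellsEquiv hα hβ hα_pos hβ_pos k
  rw [Finset.sum_filter, Finset.sum_filter]
  symm
  refine Fintype.sum_equiv (e.symm.arrowCongr (Equiv.refl _)) _ _ fun T => ?_
  have h := isSkewTableau_comp_skewCellsEquiv hα hβ hα_pos hβ_pos k T
  change _ = if IsSkewTableau (T ∘ e) then ∏ z, MvPolynomial.X (T (e z)) else 0
  rw [if_congr h rfl rfl]
  congr 1
  rw [e.prod_comp fun z => (MvPolynomial.X (T z) : MvPolynomial (Fin n) R)]
  exact Finset.prod_congr rfl fun z _ => variableSeq_val R n (T z)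

theorem elemSymm_variableSeq (R : Type*) [CommRing R] (n m : ℕ) :
    elemSymm (variableSeq R n) n m = MvPolynomial.esymm (Fin n) R m := by
  rw [elemSymm_natCast, MvPolynomial.esymm_eq_multiset_esymm]
  congr 1
  have h : (Finset.univ : Finset (Fin n)).map Fin.valEmbedding = Finset.range n := by
    rw [Fin.map_valEmbedding_univ, Nat.Iio_eq_range]
  rw [← Finset.range_val, ← h, Finset.map_val, Multiset.map_map]
  exact Multiset.map_congr rfl fun i _ => variableSeq_val R n i

theorem bandedToeplitz_esymm (R : Type*) [CommRing R] (n i j : ℕ) :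
    bandedToeplitz n (MvPolynomial.esymm (Fin n) R) i j =
      elemSymm (variableSeq R n) n ((j : ℤ) - i) := by
  unfold bandedToeplitz
  by_cases hij : i ≤ j
  · rw [← Int.ofNat_sub hij, elemSymm_variableSeq]
    split_ifs with h
    · rfl
    · rw [MvPolynomial.esymm, Finset.powersetCard_eq_empty.2 (by simp; omega), Finset.sum_empty]
  · rw [if_neg fun h => hij h.1, elemSymm_of_neg _ _ _ (by omega)]

theorem det_toeplitzD_eq_skewSchur (R : Type*) [CommRing R] (n : ℕ) {r c : ℕ} (hrc : r ≤ c)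
    {α : Fin r → ℕ} {β : Fin c → ℕ} (hα : StrictMono α) (hβ : StrictMono β)
    (hα_pos : ∀ i, 1 ≤ α i) (hβ_pos : ∀ i, 1 ≤ β i)
    (hαβ : ∀ i : Fin r, β (Fin.castLE hrc i) ≤ α i) (k : ℕ) :
    (toeplitzD n (MvPolynomial.esymm (Fin n) R) α β k).det =
      skewSchur R n (shiftedDiagram β hβ k) (shiftedDiagram α hα k) := by
  have hmono : ∀ {m : ℕ} (γ : Fin m → ℕ),
      StrictMono fun b : Fin k => (remainingIndex γ b : ℤ) := fun γ b b' h =>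
    Int.ofNat_lt.2 (strictMono_remainingIndex γ h)
  have h := det_elemSymm_eq_columnSchur (variableSeq R n) n (hmono α) (hmono β)
  have hle : (fun b : Fin k => (remainingIndex α b : ℤ)) ≤
      fun b : Fin k => (remainingIndex β b : ℤ) := fun b =>
    Int.ofNat_le.2 (remainingIndex_le_remainingIndex hrc hα hβ hα_pos hβ_pos hαβ b)
  rw [if_pos hle] at h
  rw [skewSchur_eq_columnSchur R n hα hβ hα_pos hβ_pos, ← h]
  congr 1
  ext i j : 2
  simp only [toeplitzD, Matrix.of_apply, bandedToeplitz_esymm]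

/-! ### Splitting off the first column -/

theorem le_add_lastExcess {m : ℕ} {γ : Fin m → ℕ} (hγ : StrictMono γ) (i : ℕ) (h : i < m) :
    γ ⟨i, h⟩ ≤ lastExcess m γ + (i + 1) := by
  obtain ⟨m, rfl⟩ : ∃ m', m = m' + 1 := ⟨m - 1, by omega⟩
  have key : ∀ j (hj : i ≤ j) (hjm : j < m + 1), γ ⟨i, h⟩ + (j - i) ≤ γ ⟨j, hjm⟩ := by
    intro j hj
    induction j, hj using Nat.le_induction with
    | base => simp
    | succ j hj ih =>
      intro hjm
      have h1 := ih (by omega)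
      have h2 : γ ⟨j, by omega⟩ < γ ⟨j + 1, hjm⟩ := hγ (by simp)
      omega
  have h1 := key m (by omega) (by omega)
  change _ ≤ γ (Fin.last m) - (m + 1) + (i + 1)
  rw [show (⟨m, by omega⟩ : Fin (m + 1)) = Fin.last m from rfl] at h1
  omega

theorem mem_shiftedDiagram_succ {m : ℕ} {γ : Fin m → ℕ} (hγ : StrictMono γ) (k i j : ℕ) :
    (i, j + 1) ∈ shiftedDiagram γ hγ (k + 1) ↔ (i, j) ∈ shiftedDiagram γ hγ k := by
  rw [mem_shiftedDiagram, mem_shiftedDiagram]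
  exact exists_congr fun h => by omega

/-- This is where the threshold `K` acts: `γ_i - i` is weakly increasing in `i`, so the bound on the
last term makes each of the `m` rows nonempty at `k + 1`. -/
theorem mem_shiftedDiagram_zero {m : ℕ} {γ : Fin m → ℕ} (hγ : StrictMono γ) {k : ℕ}
    (hk : lastExcess m γ ≤ k) (i : ℕ) :
    (i, 0) ∈ shiftedDiagram γ hγ (k + 1) ↔ i < m := by
  rw [mem_shiftedDiagram]
  constructor
  · exact fun h => h.1
  · intro h
    have := le_add_lastExcess hγ i h
    exact ⟨h, by omega⟩

theorem row_lt_of_mem_shiftedDiagram {m : ℕ} {γ : Fin m → ℕ} {hγ : StrictMono γ} {k i j : ℕ}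
    (h : (i, j) ∈ shiftedDiagram γ hγ k) : i < m :=
  ((mem_shiftedDiagram γ hγ k i j).1 h).1

/-- The inner diagram has only `r` rows, so from row `r` on the skew shape is closed under moving
left and up. -/
theorem mem_skewCells_of_le {r c : ℕ} {α : Fin r → ℕ} {β : Fin c → ℕ} {hα : StrictMono α}
    {hβ : StrictMono β} {k i j i' j' : ℕ}
    (h : (i, j) ∈ skewCells (shiftedDiagram β hβ k) (shiftedDiagram α hα k))
    (hr : r ≤ i') (hi : i' ≤ i) (hj : j' ≤ j) :
    (i', j') ∈ skewCells (shiftedDiagram β hβ k) (shiftedDiagram α hα k) := by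
  rw [mem_skewCells] at h ⊢
  exact ⟨YoungDiagram.up_left_mem _ hi hj h.1,
    fun h' => (row_lt_of_mem_shiftedDiagram h').not_ge hr⟩

/-- Removing the first column of the skew diagram with parameter `k + 1` leaves the skew diagram
with parameter `k`, moved by one column. -/
noncomputable def firstColumnEquiv {r c : ℕ} {α : Fin r → ℕ} {β : Fin c → ℕ}
    (hα : StrictMono α) (hβ : StrictMono β) {k : ℕ}
    (hk : max (lastExcess r α) (lastExcess c β) ≤ k) :
    Fin (c - r) ⊕ skewCells (shiftedDiagram β hβ k) (shiftedDiagram α hα k) ≃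
      skewCells (shiftedDiagram β hβ (k + 1)) (shiftedDiagram α hα (k + 1)) :=
  Equiv.ofBijective
    (Sum.elim
      (fun i => ⟨(r + i, 0), by
        rw [mem_skewCells, mem_shiftedDiagram_zero hβ ((le_max_right _ _).trans hk),
          mem_shiftedDiagram_zero hα ((le_max_left _ _).trans hk)]
        omega⟩)
      (fun z => ⟨(z.1.1, z.1.2 + 1), by
        rw [mem_skewCells, mem_shiftedDiagram_succ, mem_shiftedDiagram_succ, ← mem_skewCells]
        exact z.2⟩))
    (by
      constructor
      · rintro (i | ⟨⟨i, j⟩, hy⟩) (i' | ⟨⟨i', j'⟩, hz⟩) h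
        · simp only [Sum.elim_inl, Subtype.mk.injEq, Prod.mk.injEq] at h
          exact congrArg _ (Fin.ext (by omega))
        · simp at h
        · simp at h
        · simp only [Sum.elim_inr, Subtype.mk.injEq, Prod.mk.injEq] at h
          congr 3
          · exact h.1
          · omega
      · rintro ⟨⟨i, j⟩, hz⟩
        cases j with
        | zero =>
          have hz' := hz
          rw [mem_skewCells, mem_shiftedDiagram_zero hβ ((le_max_right _ _).trans hk),
            mem_shiftedDiagram_zero hα ((le_max_left _ _).trans hk)] at hz'
          refine ⟨Sum.inl ⟨i - r, by omega⟩, Subtype.ext (Prod.ext ?_ rfl)⟩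
          simp only [Sum.elim_inl]
          omega
        | succ j =>
          refine ⟨Sum.inr ⟨(i, j), ?_⟩, rfl⟩
          rwa [mem_skewCells, mem_shiftedDiagram_succ, mem_shiftedDiagram_succ,
            ← mem_skewCells] at hz)

/-- The entries of the first column in the rows `r, r + 1, …` are bounded below by `σ`. -/
def BoundedBelow {lam mu : YoungDiagram} {n d : ℕ} (r : ℕ) (σ : Fin d → Fin n)
    (T : skewCells lam mu → Fin n) : Prop :=
  ∀ z (i : Fin d), z.1 = (r + i, 0) → σ i ≤ T z

open Classical in
/-- The generating function of the semistandard tableaux whose first column is bounded below. -/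
noncomputable def boundedSkewSchur (R : Type*) [CommRing R] {n d : ℕ} (lam mu : YoungDiagram)
    (r : ℕ) (σ : Fin d → Fin n) : MvPolynomial (Fin n) R :=
  ∑ T : skewCells lam mu → Fin n with IsSkewTableau T ∧ BoundedBelow r σ T,
    ∏ z, MvPolynomial.X (T z)

/-- Rows above `r` have no box in the first column, so gluing that column to the rest requires only
row comparisons from row `r` on. By transitivity it suffices to compare with the adjacent column,
and this is `BoundedBelow` with the first column as the new bound. -/
theorem isSkewTableau_and_boundedBelow_iff {n r c : ℕ} {α : Fin r → ℕ} {β : Fin c → ℕ}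
    (hα : StrictMono α) (hβ : StrictMono β) {k : ℕ}
    (hk : max (lastExcess r α) (lastExcess c β) ≤ k) (σ : Fin (c - r) → Fin n)
    (T : skewCells (shiftedDiagram β hβ (k + 1)) (shiftedDiagram α hα (k + 1)) → Fin n) :
    IsSkewTableau T ∧ BoundedBelow r σ T ↔
      (StrictMono (fun i => T (firstColumnEquiv hα hβ hk (Sum.inl i))) ∧
        σ ≤ fun i => T (firstColumnEquiv hα hβ hk (Sum.inl i))) ∧
      IsSkewTableau (fun z => T (firstColumnEquiv hα hβ hk (Sum.inr z))) ∧
      BoundedBelow r (fun i => T (firstColumnEquiv hα hβ hk (Sum.inl i)))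
        (fun z => T (firstColumnEquiv hα hβ hk (Sum.inr z))) := by
  set e := firstColumnEquiv hα hβ hk with he
  have hl : ∀ i, (e (Sum.inl i)).1 = (r + i, 0) := fun i => rfl
  have hr : ∀ z, (e (Sum.inr z)).1 = (z.1.1, z.1.2 + 1) := fun z => rfl
  constructor
  · rintro ⟨⟨h1, h2⟩, h3⟩
    refine ⟨⟨fun i i' hii => h2 _ _ rfl ?_, fun i => h3 _ i (hl i)⟩,
      ⟨fun y z hyz hle => h1 _ _ ?_ ?_, fun y z hyz hlt => h2 _ _ ?_ ?_⟩,
      fun z i hz => h1 _ _ ?_ ?_⟩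
    · simpa [hl] using hii
    · simpa [hr] using hyz
    · simpa [hr] using hle
    · simpa [hr] using hyz
    · simpa [hr] using hlt
    · simp [hl, hr, hz]
    · simp [hl]
  · rintro ⟨⟨hmono, hσ⟩, ⟨h1, h2⟩, h3⟩
    refine ⟨⟨?_, ?_⟩, ?_⟩
    · intro y z
      obtain ⟨y, rfl⟩ := e.surjective y
      obtain ⟨z, rfl⟩ := e.surjective z
      rcases y with i | y <;> rcases z with i' | z <;> simp only [hl, hr]
      · intro hii _
        rw [show i = i' from Fin.ext (by omega)]
      · intro hiz _
        have hz : z.1 = (r + (i : ℕ), z.1.2) := Prod.ext hiz.symm rfl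
        -- The leftmost box of the row, before the shift by one column, mediates between the first
        -- column and `z`.
        have hz0 := mem_skewCells_of_le (i' := r + i) (j' := 0) (hz ▸ z.2) (by omega) le_rfl
          (Nat.zero_le _)
        exact (h3 ⟨_, hz0⟩ i rfl).trans (h1 ⟨_, hz0⟩ z hiz (Nat.zero_le _))
      · intro _ h
        omega
      · exact fun hyz hle => h1 y z hyz (by omega)
    · intro y z
      obtain ⟨y, rfl⟩ := e.surjective y
      obtain ⟨z, rfl⟩ := e.surjective z
      rcases y with i | y <;> rcases z with i' | z <;> simp only [hl, hr]
      · exact fun _ hlt => hmono (show (i : ℕ) < i' by omega)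
      · intro h
        omega
      · intro h
        omega
      · exact fun hyz hlt => h2 y z (by omega) hlt
    · intro z i hz
      rw [show z = e (Sum.inl i) from Subtype.ext hz]
      exact hσ i

/-! ### The transfer matrix and its characteristic polynomial -/

/-- The transfer matrix between adjacent columns of a semistandard tableau. -/
noncomputable def transferMatrix (R : Type*) [CommRing R] (n d : ℕ) :
    Matrix {τ : Lex (Fin d → Fin n) // StrictMono (ofLex τ)}
      {τ : Lex (Fin d → Fin n) // StrictMono (ofLex τ)} (MvPolynomial (Fin n) R) :=
  open Classical in Matrix.of fun σ τ =>
    if ofLex σ.1 ≤ ofLex τ.1 then ∏ i, MvPolynomial.X (ofLex τ.1 i) else 0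

open Classical in
theorem boundedSkewSchur_succ (R : Type*) [CommRing R] {n r c : ℕ} {α : Fin r → ℕ}
    {β : Fin c → ℕ} (hα : StrictMono α) (hβ : StrictMono β) {k : ℕ}
    (hk : max (lastExcess r α) (lastExcess c β) ≤ k) (σ : Fin (c - r) → Fin n) :
    boundedSkewSchur R (shiftedDiagram β hβ (k + 1)) (shiftedDiagram α hα (k + 1)) r σ =
      ∑ τ : Fin (c - r) → Fin n with StrictMono τ, (if σ ≤ τ then ∏ i, MvPolynomial.X (τ i) else 0) *
        boundedSkewSchur R (shiftedDiagram β hβ k) (shiftedDiagram α hα k) r τ := by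
  let e := firstColumnEquiv hα hβ hk
  let φ := (e.symm.arrowCongr (Equiv.refl (Fin n))).trans (Equiv.sumArrowEquivProdArrow _ _ _)
  have hφ : boundedSkewSchur R (shiftedDiagram β hβ (k + 1)) (shiftedDiagram α hα (k + 1)) r σ =
      ∑ x : (Fin (c - r) → Fin n) ×
          (skewCells (shiftedDiagram β hβ k) (shiftedDiagram α hα k) → Fin n),
        if (StrictMono x.1 ∧ σ ≤ x.1) ∧ IsSkewTableau x.2 ∧ BoundedBelow r x.1 x.2 then
          (∏ i, MvPolynomial.X (x.1 i)) * ∏ z, MvPolynomial.X (x.2 z) else 0 := by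
    rw [boundedSkewSchur, Finset.sum_filter]
    refine Fintype.sum_equiv φ _ _ fun T => ?_
    rw [if_congr (isSkewTableau_and_boundedBelow_iff hα hβ hk σ T) rfl rfl]
    refine if_congr Iff.rfl ?_ rfl
    rw [← e.prod_comp, Fintype.prod_sum_type]
    rfl
  rw [hφ, Fintype.sum_prod_type, Finset.sum_filter]
  refine Finset.sum_congr rfl fun τ _ => ?_
  by_cases h1 : StrictMono τ
  · by_cases h2 : σ ≤ τ
    · simp only [h1, h2, and_self, true_and, if_true, boundedSkewSchur, Finset.sum_filter,
        Finset.mul_sum, mul_ite, mul_zero]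
    · simp [h1, h2]
  · simp [h1]

theorem transferMatrix_mulVec_boundedSkewSchur (R : Type*) [CommRing R] {n r c : ℕ}
    {α : Fin r → ℕ} {β : Fin c → ℕ} (hα : StrictMono α) (hβ : StrictMono β) {k : ℕ}
    (hk : max (lastExcess r α) (lastExcess c β) ≤ k) :
    (transferMatrix R n (c - r)).mulVec
        (fun σ => boundedSkewSchur R (shiftedDiagram β hβ k) (shiftedDiagram α hα k) r
          (ofLex σ.1)) =
      fun σ => boundedSkewSchur R (shiftedDiagram β hβ (k + 1)) (shiftedDiagram α hα (k + 1)) r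
        (ofLex σ.1) := by
  classical
  funext σ
  rw [boundedSkewSchur_succ R hα hβ hk, Matrix.mulVec, dotProduct]
  rw [Finset.sum_subtype (p := StrictMono) _ fun τ => by simp]
  refine Fintype.sum_equiv (Equiv.refl _) _ _ fun τ => ?_
  simp only [transferMatrix, Matrix.of_apply]
  rfl

theorem transferMatrix_pow_mulVec_boundedSkewSchur (R : Type*) [CommRing R] {n r c : ℕ}
    {α : Fin r → ℕ} {β : Fin c → ℕ} (hα : StrictMono α) (hβ : StrictMono β) {j : ℕ}
    (hj : max (lastExcess r α) (lastExcess c β) ≤ j) (k : ℕ) :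
    (transferMatrix R n (c - r) ^ k).mulVec
        (fun σ => boundedSkewSchur R (shiftedDiagram β hβ j) (shiftedDiagram α hα j) r
          (ofLex σ.1)) =
      fun σ => boundedSkewSchur R (shiftedDiagram β hβ (k + j)) (shiftedDiagram α hα (k + j)) r
        (ofLex σ.1) := by
  induction k with
  | zero => simp
  | succ k ih =>
    rw [pow_succ', ← Matrix.mulVec_mulVec, ih,
      transferMatrix_mulVec_boundedSkewSchur R hα hβ (hj.trans (Nat.le_add_left j k)),
      Nat.add_right_comm k 1 j]

/-- The tuple `0, 1, …, c - r - 1` bounds every strictly increasing column from below, so it imposes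
no condition. -/
theorem skewSchur_eq_boundedSkewSchur (R : Type*) [CommRing R] {n r c : ℕ} {α : Fin r → ℕ}
    {β : Fin c → ℕ} (hα : StrictMono α) (hβ : StrictMono β) (k : ℕ) (h : c - r ≤ n) :
    skewSchur R n (shiftedDiagram β hβ k) (shiftedDiagram α hα k) =
      boundedSkewSchur R (shiftedDiagram β hβ k) (shiftedDiagram α hα k) r (Fin.castLE h) := by
  unfold skewSchur boundedSkewSchur
  congr 1
  ext T
  simp only [Finset.mem_filter, Finset.mem_univ, true_and]
  refine (and_iff_left_of_imp fun hT => ?_).symm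
  have key : ∀ i (hi : (r + i, 0) ∈ skewCells (shiftedDiagram β hβ k) (shiftedDiagram α hα k)),
      i ≤ (T ⟨_, hi⟩ : ℕ) := by
    intro i
    induction i with
    | zero => exact fun _ => Nat.zero_le _
    | succ i ih =>
      intro hi
      have hi' := mem_skewCells_of_le (i' := r + i) hi (by omega) (by omega) le_rfl
      have h1 := ih hi'
      have h2 : T ⟨_, hi'⟩ < T ⟨_, hi⟩ := hT.2 ⟨_, hi'⟩ ⟨_, hi⟩ rfl (by simp)
      rw [Fin.lt_def] at h2
      omega
  rintro ⟨_, hz⟩ i rfl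
  exact key i hz

/-- The pointwise order refines to the lexicographic one, so the matrix is upper triangular. Its
diagonal entry at `τ` is the monomial of `τ`, and strictly increasing tuples correspond to
`d`-subsets through their ranges. -/
theorem charpoly_transferMatrix (R : Type*) [CommRing R] (n d : ℕ) :
    (transferMatrix R n d).charpoly = productPoly R n d := by
  rw [Matrix.charpoly_of_isUpperTriangular, productPoly]
  · refine Finset.prod_bij (fun τ _ => Finset.univ.map ⟨ofLex τ.1, τ.2.injective⟩) ?_ ?_ ?_ ?_
    · intro τ _
      simp [Finset.mem_powersetCard]
    · intro τ _ τ' _ h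
      apply Subtype.ext
      refine (τ.2.range_inj τ'.2).1 ?_
      have := congrArg (fun s : Finset (Fin n) => (s : Set (Fin n))) h
      simpa using this
    · intro s hs
      have hs := (Finset.mem_powersetCard.1 hs).2
      refine ⟨⟨toLex (s.orderEmbOfFin hs), (s.orderEmbOfFin hs).strictMono⟩, Finset.mem_univ _, ?_⟩
      apply Finset.coe_injective
      simp
    · intro τ _
      simp [transferMatrix]
  · intro σ τ hlt
    simp only [transferMatrix, Matrix.of_apply]
    refine if_neg fun hle => ?_
    exact (Pi.toLex_monotone hle).not_gt hlt

/-! ### The recurrence from Cayley–Hamilton -/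

theorem natDegree_productPoly_le (R : Type*) [CommRing R] (n d : ℕ) :
    (productPoly R n d).natDegree ≤ n.choose d := by
  refine (Polynomial.natDegree_prod_le _ _).trans ?_
  refine (Finset.sum_le_card_nsmul _ _ 1 fun σ _ => Polynomial.natDegree_X_sub_C_le _).trans ?_
  simp

theorem recurrenceCoeff_sub (R : Type*) [CommRing R] {n d k : ℕ} (hk : k ≤ n.choose d) :
    recurrenceCoeff R n d (n.choose d - k) = (productPoly R n d).coeff k := by
  rw [recurrenceCoeff, Nat.sub_sub_self hk]

theorem sum_recurrenceCoeff_mul_X_pow (R : Type*) [CommRing R] (n d : ℕ) :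
    ∑ k ∈ Finset.range (n.choose d + 1),
      Polynomial.C (recurrenceCoeff R n d (n.choose d - k)) * Polynomial.X ^ k =
        productPoly R n d := by
  rw [Polynomial.as_sum_range_C_mul_X_pow' (productPoly R n d)
    (Nat.lt_succ_of_le (natDegree_productPoly_le R n d))]
  refine Finset.sum_congr rfl fun k hk => ?_
  rw [recurrenceCoeff_sub R (Nat.lt_succ_iff.1 (Finset.mem_range.1 hk))]

theorem sum_recurrenceCoeff_mul_skewSchur (R : Type*) [CommRing R] {n r c : ℕ} {α : Fin r → ℕ}
    {β : Fin c → ℕ} (hα : StrictMono α) (hβ : StrictMono β) {j : ℕ}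
    (hj : max (lastExcess r α) (lastExcess c β) ≤ j) (h : c - r ≤ n) :
    ∑ k ∈ Finset.range (n.choose (c - r) + 1),
      recurrenceCoeff R n (c - r) (n.choose (c - r) - k) *
        skewSchur R n (shiftedDiagram β hβ (k + j)) (shiftedDiagram α hα (k + j)) = 0 := by
  have hCH := (transferMatrix R n (c - r)).aeval_self_charpoly
  rw [charpoly_transferMatrix, Polynomial.aeval_eq_sum_range'
    (Nat.lt_succ_of_le (natDegree_productPoly_le R n (c - r)))] at hCH
  -- The matrix identity is applied to the vector at parameter `j` and read off at the smallest
  -- tuple, where the coordinates are the full skew Schur polynomials.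
  have hv := congrFun (congrArg (fun M => M.mulVec (fun σ => boundedSkewSchur R
    (shiftedDiagram β hβ j) (shiftedDiagram α hα j) r (ofLex σ.1))) hCH)
    ⟨toLex (Fin.castLE h), Fin.strictMono_castLE h⟩
  simp only [Matrix.sum_mulVec, Matrix.smul_mulVec, Matrix.zero_mulVec, Finset.sum_apply,
    Pi.smul_apply, Pi.zero_apply, smul_eq_mul,
    transferMatrix_pow_mulVec_boundedSkewSchur R hα hβ hj, ofLex_toLex] at hv
  rw [← hv]
  refine Finset.sum_congr rfl fun k hk => ?_
  rw [recurrenceCoeff_sub R (Nat.lt_succ_iff.1 (Finset.mem_range.1 hk)),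
    skewSchur_eq_boundedSkewSchur R hα hβ _ h]

theorem theorem1p2 {R : Type*} [CommRing R] (n r c : ℕ) (hrc : r ≤ c) (hcn : c ≤ n)
    (α : Fin r → ℕ) (β : Fin c → ℕ) (hα : StrictMono α) (hβ : StrictMono β)
    (hα_pos : ∀ i, 1 ≤ α i) (hβ_pos : ∀ i, 1 ≤ β i)
    (hαβ : ∀ i : Fin r, β (Fin.castLE hrc i) ≤ α i) :
    -- the characteristic polynomial of the recurrence and its roots
    (∑ k ∈ Finset.range (n.choose (c - r) + 1),
        Polynomial.C (recurrenceCoeff R n (c - r) (n.choose (c - r) - k)) * Polynomial.X ^ k =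
      ∏ σ ∈ Finset.powersetCard (c - r) (Finset.univ : Finset (Fin n)),
        (Polynomial.X - Polynomial.C (∏ i ∈ σ, MvPolynomial.X i))) ∧
    -- the recurrence for the Toeplitz minors
    (∀ j : ℕ, max (lastExcess r α) (lastExcess c β) ≤ j →
      ∑ k ∈ Finset.range (n.choose (c - r) + 1),
        recurrenceCoeff R n (c - r) (n.choose (c - r) - k) *
          (toeplitzD n (MvPolynomial.esymm (Fin n) R) α β (k + j)).det = 0) ∧
    -- the minors are skew Schur polynomials
    (∀ k : ℕ, max (lastExcess r α) (lastExcess c β) ≤ k →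
      (toeplitzD n (MvPolynomial.esymm (Fin n) R) α β k).det =
        skewSchur R n (shiftedDiagram β hβ k) (shiftedDiagram α hα k)) ∧
    -- the recurrence for the skew Schur polynomials
    (∀ j : ℕ, max (lastExcess r α) (lastExcess c β) ≤ j →
      ∑ k ∈ Finset.range (n.choose (c - r) + 1),
        recurrenceCoeff R n (c - r) (n.choose (c - r) - k) *
          skewSchur R n (shiftedDiagram β hβ (k + j)) (shiftedDiagram α hα (k + j)) = 0) := by
  have hrec := fun j hj =>
    sum_recurrenceCoeff_mul_skewSchur R hα hβ (j := j) hj ((Nat.sub_le c r).trans hcn)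
  have hdet := det_toeplitzD_eq_skewSchur R n hrc hα hβ hα_pos hβ_pos hαβ
  refine ⟨sum_recurrenceCoeff_mul_X_pow R n (c - r), fun j hj => ?_, fun k _ => hdet k, hrec⟩
  simp only [hdet]
  exact hrec j hj
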